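/- A function $f:(0,\infty)\to(0,\infty)$ is called logarithmically completely monotonic if it is $C^\infty$ and $(-1)^n(\log f)^{(n)}(x)\ge 0$ for all $x>0$ and all $n=1,2,\dots$. For real $\alpha,\beta$ let $$f_{\alpha,\beta}(x)=\frac{1}{x^{\alpha}(1+x^{\beta})},\qquad x>0.$$ Then: (i) $f_{\alpha,\beta}$ is logarithmically completely monotonic for all $\alpha\ge 0$ and $0\le\beta\le 1$; (ii) for every real $\alpha$, $f_{\alpha,2}$ is logarithmically completely monotonic if and only if $\alpha\ge 2$. -/

import Mathlib

open scoped ContDiff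

/-- A function `f : ]0, ∞[ → ]0, ∞[` is logarithmically completely monotonic if it is `C^∞` and
`(-1)^n (log f)^{(n)}(x) ≥ 0` for all `x > 0` and `n = 1, 2, …`. The function is represented by a
function on `ℝ` whose values outside `]0, ∞[` play no role. -/
def IsLogCompletelyMonotonic (f : ℝ → ℝ) : Prop :=
  (∀ x : ℝ, 0 < x → 0 < f x) ∧
  ContDiffOn ℝ ∞ f (Set.Ioi 0) ∧
  ∀ n : ℕ, 1 ≤ n → ∀ x : ℝ, 0 < x →
    0 ≤ (-1 : ℝ) ^ n * iteratedDeriv n (fun y : ℝ => Real.log (f y)) x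

/-- The function `f_{α,β}(x) = 1 / (x^α (1 + x^β))`, considered for `x > 0`. -/
noncomputable def dagumAux (α β : ℝ) (x : ℝ) : ℝ :=
  1 / (x ^ α * (1 + x ^ β))

/-!
Write `f = dagumAux α β`. Since `log f = -α log x - log (1 + x ^ β)`, the function `f` is
logarithmically completely monotonic as soon as
`-(log f)' = α / x + β x ^ (β - 1) / (1 + x ^ β)` is completely monotonic.

For `0 ≤ β ≤ 1` the second summand equals `β / (x ^ (1 - β) + x)`. The denominator is positive with
completely monotonic derivative, so its reciprocal is completely monotonic
(`CMUpTo.inv_of_hasDerivAt`): differentiating `1 / B` gives `-B' * (1 / B) ^ 2`, and complete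
monotonicity is stable under products.

For `β = 2` the second summand is `2 Re (1 / (x + i))`, so the `n`-th derivative of `log f`, `n ≥ 1`,
equals `(-1) ^ n (n - 1)! (α x ^ (-n) + 2 Re (x + i) ^ (-n))` (`iteratedDeriv_log_dagumAux_two`).
If `α ≥ 2`, the sign is right because `|x + i| ≥ x`. Conversely, multiplying by `x ^ n`
at `x = n / π` gives `α + 2 Re (1 + i π / n) ^ (-n) ≥ 0`, and the left side tends to
`α + 2 Re (exp (-i π)) = α - 2`.
-/

/-! ### Complete monotonicity up to a finite order -/

/-- `CMUpTo n f`: on `]0, ∞[`, the function `f` is `n` times differentiable and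
`(-1) ^ k f ^ (k) ≥ 0` for all `k ≤ n`. The recursion runs over `f ↦ -f'`, with the derivative given
by an arbitrary function on `ℝ` whose values outside `]0, ∞[` play no role. -/
def CMUpTo : ℕ → (ℝ → ℝ) → Prop
  | 0, f => ∀ x, 0 < x → 0 ≤ f x
  | n + 1, f => (∀ x, 0 < x → 0 ≤ f x) ∧
      ∃ g : ℝ → ℝ, (∀ x, 0 < x → HasDerivAt f (-g x) x) ∧ CMUpTo n g

namespace CMUpTo

theorem of_succ {n : ℕ} {f : ℝ → ℝ} (h : CMUpTo (n + 1) f) : CMUpTo n f := by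
  induction n generalizing f with
  | zero => exact h.1
  | succ n ih =>
    obtain ⟨h0, g, hg, hn⟩ := h
    exact ⟨h0, g, hg, ih hn⟩

theorem add {n : ℕ} {f g : ℝ → ℝ} (hf : CMUpTo n f) (hg : CMUpTo n g) :
    CMUpTo n (fun x => f x + g x) := by
  induction n generalizing f g with
  | zero => exact fun x hx => add_nonneg (hf x hx) (hg x hx)
  | succ n ih =>
    obtain ⟨hf0, f', hf', hfn⟩ := hf
    obtain ⟨hg0, g', hg', hgn⟩ := hg
    refine ⟨fun x hx => add_nonneg (hf0 x hx) (hg0 x hx), _, fun x hx => ?_, ih hfn hgn⟩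
    exact ((hf' x hx).add (hg' x hx)).congr_deriv (by ring)

theorem mul {n : ℕ} {f g : ℝ → ℝ} (hf : CMUpTo n f) (hg : CMUpTo n g) :
    CMUpTo n (fun x => f x * g x) := by
  induction n generalizing f g with
  | zero => exact fun x hx => mul_nonneg (hf x hx) (hg x hx)
  | succ n ih =>
    have hf1 := hf.of_succ
    have hg1 := hg.of_succ
    obtain ⟨hf0, f', hf', hfn⟩ := hf
    obtain ⟨hg0, g', hg', hgn⟩ := hg
    refine ⟨fun x hx => mul_nonneg (hf0 x hx) (hg0 x hx), _, fun x hx => ?_,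
      (ih hfn hg1).add (ih hf1 hgn)⟩
    exact ((hf' x hx).mul (hg' x hx)).congr_deriv (by ring)

theorem const (n : ℕ) {c : ℝ} (hc : 0 ≤ c) : CMUpTo n (fun _ => c) := by
  induction n generalizing c with
  | zero => exact fun _ _ => hc
  | succ n ih =>
    refine ⟨fun _ _ => hc, _, fun x _ => ?_, ih le_rfl⟩
    simpa using hasDerivAt_const x c

theorem rpow_neg (n : ℕ) {p : ℝ} (hp : 0 ≤ p) : CMUpTo n (fun x => x ^ (-p)) := by
  induction n generalizing p with
  | zero => exact fun x hx => (Real.rpow_pos_of_pos hx _).le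
  | succ n ih =>
    refine ⟨fun x hx => (Real.rpow_pos_of_pos hx _).le, _, fun x hx => ?_,
      (const n hp).mul (ih (by linarith : 0 ≤ p + 1))⟩
    convert Real.hasDerivAt_rpow_const (p := -p) (Or.inl hx.ne') using 1
    rw [neg_add']
    ring

/-- The reciprocal of a positive function with completely monotonic derivative (a Bernstein
function) is completely monotonic. -/
theorem inv_of_hasDerivAt {B h : ℝ → ℝ} (hB : ∀ x, 0 < x → 0 < B x)
    (hd : ∀ x, 0 < x → HasDerivAt B (h x) x) (hh : ∀ n, CMUpTo n h) (n : ℕ) :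
    CMUpTo n (fun x => (B x)⁻¹) := by
  induction n with
  | zero => exact fun x hx => (inv_pos.2 (hB x hx)).le
  | succ n ih =>
    refine ⟨fun x hx => (inv_pos.2 (hB x hx)).le, _, fun x hx => ?_, (hh n).mul (ih.mul ih)⟩
    have := (hB x hx).ne'
    exact ((hd x hx).inv this).congr_deriv (by field_simp)

theorem iteratedDeriv_nonneg {n : ℕ} {f : ℝ → ℝ} (h : CMUpTo n f) {x : ℝ} (hx : 0 < x) :
    0 ≤ (-1 : ℝ) ^ n * iteratedDeriv n f x := by
  induction n generalizing f with
  | zero => simpa using h x hx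
  | succ n ih =>
    obtain ⟨-, g, hg, hn⟩ := h
    have he : deriv f =ᶠ[nhds x] -g := by
      filter_upwards [Ioi_mem_nhds hx] with y hy using (hg y hy).deriv
    rw [iteratedDeriv_succ', he.iteratedDeriv_eq, iteratedDeriv_neg, pow_succ]
    linarith [ih hn]

end CMUpTo

/-! ### Smoothness and the logarithmic derivative -/

theorem dagumAux_pos (α β : ℝ) {x : ℝ} (hx : 0 < x) : 0 < dagumAux α β x := by
  unfold dagumAux
  positivity

theorem contDiffOn_dagumAux (α β : ℝ) : ContDiffOn ℝ ∞ (dagumAux α β) (Set.Ioi 0) := by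
  intro x hx
  have hx : 0 < x := hx
  have h (p : ℝ) : ContDiffAt ℝ ∞ (fun y : ℝ => y ^ p) x :=
    Real.contDiffAt_rpow_const_of_ne hx.ne'
  have hne : x ^ α * (1 + x ^ β) ≠ 0 := by positivity
  exact (contDiffAt_const.div ((h α).mul (contDiffAt_const.add (h β))) hne).contDiffWithinAt

theorem hasDerivAt_log_dagumAux (α β : ℝ) {x : ℝ} (hx : 0 < x) :
    HasDerivAt (fun y => Real.log (dagumAux α β y))
      (-(α * x⁻¹ + β * x ^ (β - 1) / (1 + x ^ β))) x := by
  have hne : 1 + x ^ β ≠ 0 := by positivity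
  have h := ((Real.hasDerivAt_log hx.ne').const_mul α).neg.sub
    (((Real.hasDerivAt_rpow_const (p := β) (Or.inl hx.ne')).const_add 1).log hne)
  refine (h.congr_of_eventuallyEq ?_).congr_deriv (by ring)
  filter_upwards [Ioi_mem_nhds hx] with y hy
  have hy : 0 < y := hy
  simp only [dagumAux, one_div, Real.log_inv, Pi.neg_apply, Pi.sub_apply]
  rw [Real.log_mul (by positivity) (by positivity), Real.log_rpow hy]
  ring

/-! ### Exponents between zero and one -/

theorem CMUpTo.neg_logDeriv_dagumAux {α β : ℝ} (hα : 0 ≤ α) (hβ : 0 ≤ β) (hβ' : β ≤ 1) (n : ℕ) :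
    CMUpTo n (fun x => α * x ^ (-1 : ℝ) + β * (x ^ (1 - β) + x)⁻¹) := by
  refine ((const n hα).mul (rpow_neg n zero_le_one)).add ((const n hβ).mul
    (inv_of_hasDerivAt (h := fun x => (1 - β) * x ^ (-β) + 1) ?_ ?_ ?_ n))
  · intro x hx
    positivity
  · intro x hx
    refine ((Real.hasDerivAt_rpow_const (p := 1 - β) (Or.inl hx.ne')).add
      (hasDerivAt_id x)).congr_deriv ?_
    rw [sub_sub_cancel_left]
  · exact fun m => ((const m (sub_nonneg.2 hβ')).mul (rpow_neg m hβ)).add (const m zero_le_one)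

theorem isLogCompletelyMonotonic_dagumAux {α β : ℝ} (hα : 0 ≤ α) (hβ : 0 ≤ β) (hβ' : β ≤ 1) :
    IsLogCompletelyMonotonic (dagumAux α β) := by
  refine ⟨fun x hx => dagumAux_pos α β hx, contDiffOn_dagumAux α β, fun n hn x hx => ?_⟩
  obtain ⟨m, rfl⟩ := Nat.exists_eq_add_of_le' hn
  have he : deriv (fun y => Real.log (dagumAux α β y)) =ᶠ[nhds x]
      -fun y => α * y ^ (-1 : ℝ) + β * (y ^ (1 - β) + y)⁻¹ := by
    filter_upwards [Ioi_mem_nhds hx] with y hy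
    have hy : 0 < y := hy
    rw [(hasDerivAt_log_dagumAux α β hy).deriv, Pi.neg_apply, Real.rpow_neg_one,
      Real.rpow_sub hy, Real.rpow_sub hy, Real.rpow_one]
    have : 0 < y ^ β := by positivity
    congr 2
    field_simp
  rw [iteratedDeriv_succ', he.iteratedDeriv_eq, iteratedDeriv_neg, pow_succ]
  linarith [(CMUpTo.neg_logDeriv_dagumAux hα hβ hβ' m).iteratedDeriv_nonneg hx]

/-! ### Exponent two -/

theorem ofReal_add_I_ne_zero (x : ℝ) : (x : ℂ) + Complex.I ≠ 0 := by
  intro h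
  simpa using congrArg Complex.im h

theorem hasDerivAt_inv_pow_add_re_inv_pow (α : ℝ) (n : ℕ) {x : ℝ} (hx : 0 < x) :
    HasDerivAt (fun y : ℝ => α * (y⁻¹) ^ (n + 1) + 2 * ((((y : ℂ) + Complex.I)⁻¹) ^ (n + 1)).re)
      (-(n + 1 : ℝ) * (α * (x⁻¹) ^ (n + 2) + 2 * ((((x : ℂ) + Complex.I)⁻¹) ^ (n + 2)).re)) x := by
  have h1 := ((hasDerivAt_inv hx.ne').pow (n + 1)).const_mul α
  have h2 : HasDerivAt (fun z : ℂ => ((z + Complex.I)⁻¹) ^ (n + 1))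
      (-(n + 1 : ℝ) * (((x : ℂ) + Complex.I)⁻¹) ^ (n + 2)) (x : ℂ) := by
    refine ((((hasDerivAt_id (x : ℂ)).add_const Complex.I).inv
      (ofReal_add_I_ne_zero x)).pow (n + 1)).congr_deriv ?_
    simp only [id, Pi.inv_apply, Nat.add_sub_cancel, div_eq_mul_inv, ← inv_pow]
    push_cast
    ring
  refine (h1.add (h2.real_of_complex.const_mul 2)).congr_deriv ?_
  rw [← Complex.ofReal_neg, Complex.re_ofReal_mul]
  simp only [Nat.add_sub_cancel, ← inv_pow]
  push_cast
  ring

theorem iteratedDeriv_log_dagumAux_two (α : ℝ) (n : ℕ) {x : ℝ} (hx : 0 < x) :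
    iteratedDeriv (n + 1) (fun y => Real.log (dagumAux α 2 y)) x =
      (-1) ^ (n + 1) * n.factorial *
        (α * (x⁻¹) ^ (n + 1) + 2 * ((((x : ℂ) + Complex.I)⁻¹) ^ (n + 1)).re) := by
  induction n generalizing x with
  | zero =>
    rw [zero_add, iteratedDeriv_one, (hasDerivAt_log_dagumAux α 2 hx).deriv]
    have : (2 : ℝ) - 1 = 1 := by norm_num
    simp only [this, Real.rpow_one, Real.rpow_two, pow_one, Complex.inv_re, Complex.normSq_apply,
      Complex.add_re, Complex.add_im, Complex.ofReal_re, Complex.ofReal_im, Complex.I_re,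
      Complex.I_im, Nat.factorial_zero, Nat.cast_one]
    ring
  | succ n ih =>
    have he : iteratedDeriv (n + 1) (fun y => Real.log (dagumAux α 2 y)) =ᶠ[nhds x] fun y =>
        (-1) ^ (n + 1) * n.factorial *
          (α * (y⁻¹) ^ (n + 1) + 2 * ((((y : ℂ) + Complex.I)⁻¹) ^ (n + 1)).re) := by
      filter_upwards [Ioi_mem_nhds hx] with y hy using ih hy
    rw [iteratedDeriv_succ, he.deriv_eq,
      ((hasDerivAt_inv_pow_add_re_inv_pow α n hx).const_mul _).deriv, Nat.factorial_succ]
    push_cast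
    ring

theorem abs_re_inv_pow_le {x : ℝ} (hx : 0 < x) (n : ℕ) :
    |((((x : ℂ) + Complex.I)⁻¹) ^ n).re| ≤ (x⁻¹) ^ n := by
  refine (Complex.abs_re_le_norm _).trans ?_
  rw [norm_pow, norm_inv]
  have h : x ≤ ‖(x : ℂ) + Complex.I‖ := by
    simpa [abs_of_pos hx] using Complex.abs_re_le_norm ((x : ℂ) + Complex.I)
  gcongr

theorem tendsto_re_one_add_inv_pow :
    Filter.Tendsto (fun n : ℕ => (((1 + (Real.pi * Complex.I) / n : ℂ) ^ n)⁻¹).re)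
      Filter.atTop (nhds (-1)) := by
  have h := (Complex.tendsto_one_add_div_pow_exp (Real.pi * Complex.I)).inv₀
    (Complex.exp_ne_zero _)
  rw [Complex.exp_pi_mul_I] at h
  have h2 := (Complex.continuous_re.tendsto _).comp h
  norm_num at h2
  simpa [Function.comp_def] using h2

theorem isLogCompletelyMonotonic_dagumAux_two_iff (α : ℝ) :
    IsLogCompletelyMonotonic (dagumAux α 2) ↔ 2 ≤ α := by
  have key (n : ℕ) {x : ℝ} (hx : 0 < x) :
      (-1 : ℝ) ^ (n + 1) * iteratedDeriv (n + 1) (fun y => Real.log (dagumAux α 2 y)) x =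
        n.factorial *
          (α * (x⁻¹) ^ (n + 1) + 2 * ((((x : ℂ) + Complex.I)⁻¹) ^ (n + 1)).re) := by
    rw [iteratedDeriv_log_dagumAux_two α n hx, ← mul_assoc, ← mul_assoc, ← mul_pow]
    norm_num
  constructor
  · rintro ⟨-, -, h⟩
    have hlim := (tendsto_re_one_add_inv_pow.const_mul 2).const_add α
    suffices 0 ≤ α + 2 * (-1) by linarith
    refine ge_of_tendsto hlim ?_
    filter_upwards [Filter.eventually_ge_atTop 1] with n hn
    obtain ⟨m, rfl⟩ := Nat.exists_eq_add_of_le' hn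
    have hN : (0 : ℝ) < (m + 1 : ℕ) := by positivity
    set N : ℕ := m + 1
    -- Scaling by `x = N / π` turns `x + i` into `x * (1 + i π / N)`.
    have hx : 0 < (N : ℝ) / Real.pi := div_pos hN Real.pi_pos
    have h1 := h N hn _ hx
    rw [key m hx] at h1
    have h2 := nonneg_of_mul_nonneg_right h1 (by positivity)
    have hfac : (((N : ℝ) / Real.pi : ℝ) : ℂ) + Complex.I =
        (((N : ℝ) / Real.pi : ℝ) : ℂ) * (1 + (Real.pi * Complex.I) / N) := by
      have hNc : (N : ℂ) ≠ 0 := by exact_mod_cast hN.ne'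
      have hpi : (Real.pi : ℂ) ≠ 0 := by exact_mod_cast Real.pi_ne_zero
      push_cast
      field_simp
    rw [hfac, mul_inv, mul_pow, ← Complex.ofReal_inv, ← Complex.ofReal_pow,
      Complex.re_ofReal_mul, inv_pow (1 + _ : ℂ)] at h2
    refine nonneg_of_mul_nonneg_right (a := (((N : ℝ) / Real.pi)⁻¹) ^ N) ?_ (by positivity)
    linarith
  · intro hα
    refine ⟨fun x hx => dagumAux_pos α 2 hx, contDiffOn_dagumAux α 2, fun n hn x hx => ?_⟩
    obtain ⟨m, rfl⟩ := Nat.exists_eq_add_of_le' hn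
    rw [key m hx]
    have h1 := neg_le_of_abs_le (abs_re_inv_pow_le hx (m + 1))
    have h2 : 0 ≤ (x⁻¹) ^ (m + 1) := by positivity
    exact mul_nonneg (by positivity) (by nlinarith)

theorem theorem6 :
    (∀ α β : ℝ, 0 ≤ α → 0 ≤ β → β ≤ 1 → IsLogCompletelyMonotonic (dagumAux α β)) ∧
    (∀ α : ℝ, IsLogCompletelyMonotonic (dagumAux α 2) ↔ 2 ≤ α) :=
  ⟨fun _ _ => isLogCompletelyMonotonic_dagumAux, isLogCompletelyMonotonic_dagumAux_two_iff⟩
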